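/- Let $V$ be a finite-dimensional complex vector space and let $S^dV$ be the space of homogeneous polynomials of degree $d$ on $V^*$. For $P\in S^dV$ the symmetric rank $R_s(P)$ is the least $r\in\mathbb{N}$ such that $P=\sum_{i=1}^r v_i^d$ with $v_1,\dots,v_r\in V$, and the symmetric border rank $\underline{R}_s(P)$ is the least $r\in\mathbb{N}$ such that $P$ lies in the Zariski closure, in $S^dV$, of $\{T\in S^dV: R_s(T)=r\}$. Let $\det_n\in S^n(\mathbb{C}^{n\times n})$ denote the determinant of the generic $n\times n$ matrix, a homogeneous polynomial of degree $n$ in the $n^2$ matrix entries. Let $n\ge 5$. Then $\underline{R}_s(\det_n)$ is a (finite) natural number. If $n$ is even, then \[ \underline{R}_s(\textstyle\det_n)\;\ge\;\left(1+\frac{8(n^3+6n^2-8)}{(n-1)(n+2)(n+4)^2(n^2-2)}\right)\binom{n}{n/2}^2, \] and if $n$ is odd, then \[ \underline{R}_s(\textstyle\det_n)\;\ge\;\left(1+\frac{16(n^2+8n+9)}{(n+3)(n+5)^2(n^2-2)}\right)\binom{n}{(n-1)/2}^2. \] -/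

import Mathlib

noncomputable section

open MvPolynomial

/-- `S^d V` for the complex vector space `V` with basis `σ`: the homogeneous polynomials of
degree `d` in the variables `σ`. In particular `SymPow σ 1` is `V` itself, the linear forms. -/
abbrev SymPow (σ : Type*) (d : ℕ) : Submodule ℂ (MvPolynomial σ ℂ) :=
  homogeneousSubmodule σ ℂ d

/-- The polynomial functions on a complex vector space: the algebra of functions generated by
the linear functionals. -/
def polyFunctions (W : Type*) [AddCommGroup W] [Module ℂ W] : Subalgebra ℂ (W → ℂ) :=
  Algebra.adjoin ℂ (Set.range fun φ : Module.Dual ℂ W => (φ : W → ℂ))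

/-- The Zariski closure of a subset `S` of a complex vector space: the common zeros of all
polynomial functions that vanish on `S`. -/
def zariskiClosure {W : Type*} [AddCommGroup W] [Module ℂ W] (S : Set W) : Set W :=
  {w | ∀ F ∈ polyFunctions W, (∀ s ∈ S, F s = 0) → F w = 0}

/-- The symmetric rank of `P ∈ S^d V`: the least `r` such that `P` is a sum of `r` `d`-th powers
of elements of `V` (`⊤` if there is no such `r`). -/
def symmetricRank {σ : Type*} {d : ℕ} (P : SymPow σ d) : ℕ∞ :=
  sInf ((fun r : ℕ => (r : ℕ∞)) ''
    {r : ℕ | ∃ v : Fin r → SymPow σ 1,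
      (P : MvPolynomial σ ℂ) = ∑ i, (v i : MvPolynomial σ ℂ) ^ d})

/-- The symmetric border rank of `P ∈ S^d V`: the least `r` such that `P` lies in the Zariski
closure, in `S^d V`, of the set of forms of symmetric rank `r` (`⊤` if there is no such `r`). -/
def symmetricBorderRank {σ : Type*} {d : ℕ} (P : SymPow σ d) : ℕ∞ :=
  sInf ((fun r : ℕ => (r : ℕ∞)) ''
    {r : ℕ | P ∈ zariskiClosure {T : SymPow σ d | symmetricRank T = (r : ℕ∞)}})

/-- The determinant of the generic `n × n` matrix, a form of degree `n` in the `n²` entries. -/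
def detForm (n : ℕ) : SymPow (Fin n × Fin n) n :=
  ⟨(Matrix.mvPolynomialX (Fin n) (Fin n) ℂ).det, by
    rw [mem_homogeneousSubmodule, Matrix.det_apply]
    refine IsHomogeneous.sum _ _ _ fun τ _ => ?_
    rw [← mem_homogeneousSubmodule, Units.smul_def]
    refine zsmul_mem ?_ _
    rw [mem_homogeneousSubmodule]
    have h := IsHomogeneous.prod (Finset.univ : Finset (Fin n))
      (fun i => Matrix.mvPolynomialX (Fin n) (Fin n) ℂ (τ i) i) (fun _ => 1)
      (fun i _ => isHomogeneous_X ℂ (τ i, i))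
    simpa using h⟩

end

/-!
Write `N = n ^ 2` and `k + l + 1 = n`. The Koszul flattening of `P`, which sends `D ⊗ ω` in
`S^l ⊗ ⋀³` to the Koszul differential of `D(∂) P ⊗ ω` in `S^k ⊗ ⋀²`, is linear in `P`. For a power
`P = v ^ n` its image is `v ^ k` tensored with the contractions of `⋀³` by `v`, so its rank is at
most `(N - 1).choose 2`; since a bound on the rank of a matrix is a Zariski closed condition, the
rank is at most `r * (N - 1).choose 2` for every `P` of border rank `r`.

For the determinant, `S(∂) det` is zero or a signed complementary minor, and exchanging the columns
of two cells of `S` changes its sign. The brackets `S(∂) det ⊗ e_a ∧ e_b` with `|S| = l + 1` and `S`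
a chain, each cell lying strictly to the lower right of the previous one, are linearly independent.
Modulo the image of the flattening, straightening expresses all of them through one bracket for each
pair of a chain `E` of length `l + 2` and a cell `b` that does not precede all of `E`. The pairs in
which `b` does precede `E` include the chains of length `l + 3`, so at most
`N * n.choose (l + 2) ^ 2 - n.choose (l + 3) ^ 2` brackets remain, and the rank of the flattening is
at least the number `n.choose (l + 1) ^ 2 * N.choose 2` of independent brackets minus this one.
-/

open MvPolynomial

section Derivative

variable {σ R : Type*} [DecidableEq σ] [CommSemiring R]

/-- The iterated partial derivative along the variables listed in `m`, evaluated at the origin,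
that is, the apolar pairing with the monomial `m`. Monomials are encoded as multisets of
variables throughout. -/
noncomputable def derivAtZero (m : Multiset σ) : MvPolynomial σ R →ₗ[R] R :=
  (((Multiset.toFinsupp m).prod fun _ k => k.factorial : ℕ) : R) • lcoeff R (Multiset.toFinsupp m)

theorem derivAtZero_apply (m : Multiset σ) (P : MvPolynomial σ R) :
    derivAtZero m P =
      (((Multiset.toFinsupp m).prod fun _ k => k.factorial : ℕ) : R) *
        coeff (Multiset.toFinsupp m) P := by
  simp [derivAtZero, lcoeff_apply]

theorem derivAtZero_linearForm_pow [Fintype σ] (v : σ → R) (m : Multiset σ) :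
    derivAtZero m ((∑ i, v i • X i) ^ m.card) = (m.card.factorial : R) * (m.map v).prod := by
  have hcard : ((Multiset.toFinsupp m).sum fun _ k => k) = m.card := Multiset.toFinsupp_sum_eq m
  have hprod : ((Multiset.toFinsupp m).prod fun i k => v i ^ k) = (m.map v).prod := by
    simp [Finsupp.prod, Finset.prod_multiset_map_count]
  have hfac : ((Multiset.toFinsupp m).prod fun _ k => k.factorial) *
      (Multiset.toFinsupp m).multinomial = m.card.factorial := by
    rw [← hcard]
    exact Nat.multinomial_spec _ _
  rw [derivAtZero_apply, coeff_linearCombination_X_pow_of_fintype, if_pos hcard, hprod,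
    ← mul_assoc, ← Nat.cast_mul, hfac]

end Derivative

section Wedge

variable {σ R : Type*} [CommRing R]

/-- The bivector `x ∧ y`, given by its Plücker coordinates. -/
def wedge (x y : σ → R) : σ × σ → R := fun p => x p.1 * y p.2 - x p.2 * y p.1

theorem wedge_swap (x y : σ → R) : wedge x y = -wedge y x := by
  ext p
  simp only [wedge, Pi.neg_apply]
  ring

/-- The contraction of `e_a ∧ e_b ∧ e_c` with the functional `v`. -/
def contraction [DecidableEq σ] (v : σ → R) (a b c : σ) : σ × σ → R :=
  v a • wedge (Pi.single b 1) (Pi.single c 1) - v b • wedge (Pi.single a 1) (Pi.single c 1) +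
    v c • wedge (Pi.single a 1) (Pi.single b 1)

end Wedge

section WedgeRank

variable {σ K : Type*} [Field K]

theorem finrank_span_range_alternatingMap_le {M N : Type*} [AddCommGroup M] [Module K M]
    [Module.Finite K M] [AddCommGroup N] [Module K N] {k : ℕ} (f : M [⋀^Fin k]→ₗ[K] N) :
    Module.finrank K (Submodule.span K (Set.range f)) ≤ (Module.finrank K M).choose k := by
  have hspan : Submodule.span K (Set.range f) ≤
      LinearMap.range (exteriorPower.alternatingMapLinearEquiv f) :=
    Submodule.span_le.2 <| Set.range_subset_iff.2 fun x =>
      ⟨exteriorPower.ιMulti K k x, exteriorPower.alternatingMapLinearEquiv_apply_ιMulti f x⟩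
  rw [← exteriorPower.finrank_eq]
  exact (Submodule.finrank_mono hspan).trans (LinearMap.finrank_range_le _)

theorem finrank_span_wedge_le [Finite σ] (U : Submodule K (σ → K)) :
    Module.finrank K (Submodule.span K {w | ∃ x ∈ U, ∃ y ∈ U, wedge x y = w}) ≤
      (Module.finrank K U).choose 2 := by
  let f : U [⋀^Fin 2]→ₗ[K] (σ × σ → K) := AlternatingMap.pi fun p =>
    Matrix.detRowAlternating.compLinearMap (LinearMap.funLeft K K ![p.1, p.2] ∘ₗ U.subtype)
  have hf : ∀ x y : U, f ![x, y] = wedge (x : σ → K) y := fun x y => by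
    ext p
    exact (Matrix.det_fin_two _).trans (by simp [wedge])
  refine (Submodule.finrank_mono (Submodule.span_mono ?_)).trans
    (finrank_span_range_alternatingMap_le f)
  rintro _ ⟨x, hx, y, hy, rfl⟩
  exact ⟨![⟨x, hx⟩, ⟨y, hy⟩], hf _ _⟩

theorem finrank_span_contraction_le [Fintype σ] [DecidableEq σ] (v : σ → K) :
    Module.finrank K (Submodule.span K
      (Set.range fun x : σ × σ × σ => contraction v x.1 x.2.1 x.2.2)) ≤
        (Fintype.card σ - 1).choose 2 := by
  obtain rfl | hv := eq_or_ne v 0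
  · have : Submodule.span K
        (Set.range fun x : σ × σ × σ => contraction (0 : σ → K) x.1 x.2.1 x.2.2) = ⊥ :=
      Submodule.span_eq_bot.2 (by rintro _ ⟨x, rfl⟩; simp [contraction])
    rw [this, finrank_bot]
    exact Nat.zero_le _
  obtain ⟨o, ho⟩ := Function.ne_iff.1 hv
  set φ : Module.Dual K (σ → K) := Fintype.linearCombination K v with hφ
  have hφe : ∀ p, φ (Pi.single p 1) = v p := fun p => by simp [hφ]
  have hker : Module.finrank K (LinearMap.ker φ) = Fintype.card σ - 1 := by
    have hne : φ ≠ 0 := fun h => ho (by simp [← hφe, h])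
    have := Module.Dual.finrank_ker_add_one_of_ne_zero hne
    rw [Module.finrank_fintype_fun_eq_card] at this
    omega
  rw [← hker]
  refine le_trans (Submodule.finrank_mono (Submodule.span_le.2 ?_)) (finrank_span_wedge_le _)
  rintro _ ⟨⟨a, b, c⟩, rfl⟩
  let e : σ → σ → K := fun p => Pi.single p 1 - (v p / v o) • Pi.single o 1
  have he : ∀ p, e p ∈ LinearMap.ker φ := fun p => by
    have : v o ≠ 0 := ho
    simp [e, hφe, this]
  have hmem : ∀ p q, wedge (e p) (e q) ∈ Submodule.span K
      {w | ∃ x ∈ LinearMap.ker φ, ∃ y ∈ LinearMap.ker φ, wedge x y = w} :=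
    fun p q => Submodule.subset_span ⟨_, he p, _, he q, rfl⟩
  have : contraction v a b c =
      v a • wedge (e b) (e c) - v b • wedge (e a) (e c) + v c • wedge (e a) (e b) := by
    ext y
    simp only [contraction, wedge, e, Pi.add_apply, Pi.sub_apply, Pi.smul_apply, smul_eq_mul]
    ring
  change contraction v a b c ∈ _
  rw [this]
  exact add_mem (sub_mem (Submodule.smul_mem _ _ (hmem _ _)) (Submodule.smul_mem _ _ (hmem _ _)))
    (Submodule.smul_mem _ _ (hmem _ _))

end WedgeRank

section Koszul

variable {σ R : Type*} [DecidableEq σ] [CommRing R] {k : ℕ}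

/-- The element `m(∂) P ⊗ e_a ∧ e_b` of the target of a Koszul flattening of `P`, where the
polynomial `m(∂) P` is recorded by its pairings with the monomials of degree `k`. -/
noncomputable def bracket (k : ℕ) (P : MvPolynomial σ R) (m : Multiset σ) (a b : σ) :
    Sym σ k × σ × σ → R :=
  fun y => derivAtZero ((y.1 : Multiset σ) + m) P * wedge (Pi.single a 1) (Pi.single b 1) y.2

theorem bracket_swap (P : MvPolynomial σ R) (m : Multiset σ) (a b : σ) :
    bracket k P m a b = -bracket k P m b a := by
  ext y
  simp [bracket, wedge_swap (Pi.single a 1) (Pi.single b (1 : R))]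

/-- The Koszul flattening `S^l ⊗ ⋀³ → S^k ⊗ ⋀²` of `P`: its row at `(D, a, b, c)` is the Koszul
differential of `D(∂) P ⊗ e_a ∧ e_b ∧ e_c`. -/
noncomputable def koszulFlattening (k l : ℕ) :
    MvPolynomial σ R →ₗ[R] Matrix (Sym σ l × σ × σ × σ) (Sym σ k × σ × σ) R where
  toFun P := Matrix.of fun x =>
    bracket k P (x.2.1 ::ₘ x.1) x.2.2.1 x.2.2.2 - bracket k P (x.2.2.1 ::ₘ x.1) x.2.1 x.2.2.2 +
      bracket k P (x.2.2.2 ::ₘ x.1) x.2.1 x.2.2.1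
  map_add' P Q := by
    ext x y
    simp only [bracket, Matrix.of_apply, Matrix.add_apply, Pi.add_apply, Pi.sub_apply, map_add]
    ring
  map_smul' c P := by
    ext x y
    simp only [bracket, Matrix.of_apply, Matrix.smul_apply, Pi.add_apply, Pi.sub_apply, map_smul,
      smul_eq_mul, RingHom.id_apply]
    ring

theorem koszulFlattening_linearForm_pow [Fintype σ] (v : σ → R) {l : ℕ}
    (x : Sym σ l × σ × σ × σ) (y : Sym σ k × σ × σ) :
    koszulFlattening k l ((∑ i, v i • X i : MvPolynomial σ R) ^ (k + l + 1)) x y =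
      (((k + l + 1).factorial : R) * ((x.1 : Multiset σ).map v).prod) *
        (((y.1 : Multiset σ).map v).prod * contraction v x.2.1 x.2.2.1 x.2.2.2 y.2) := by
  have hderiv : ∀ a : σ, derivAtZero ((y.1 : Multiset σ) + a ::ₘ (x.1 : Multiset σ))
      ((∑ i, v i • X i) ^ (k + l + 1)) = ((k + l + 1).factorial : R) *
        (((y.1 : Multiset σ).map v).prod * (v a * ((x.1 : Multiset σ).map v).prod)) := fun a => by
    have h := derivAtZero_linearForm_pow v ((y.1 : Multiset σ) + a ::ₘ (x.1 : Multiset σ))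
    have hcard : ((y.1 : Multiset σ) + a ::ₘ (x.1 : Multiset σ)).card = k + l + 1 := by
      simp [add_assoc]
    rwa [hcard, Multiset.map_add, Multiset.map_cons, Multiset.prod_add, Multiset.prod_cons] at h
  simp only [koszulFlattening, LinearMap.coe_mk, AddHom.coe_mk, Matrix.of_apply, bracket,
    Pi.add_apply, Pi.sub_apply, hderiv, contraction, Pi.smul_apply, smul_eq_mul]
  ring

end Koszul

section KoszulRank

variable {σ K : Type*} [Fintype σ] [DecidableEq σ] [Field K] {k l : ℕ}

theorem rank_koszulFlattening_linearForm_pow_le (v : σ → K) :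
    (koszulFlattening k l ((∑ i, v i • X i : MvPolynomial σ K) ^ (k + l + 1))).rank ≤
      (Fintype.card σ - 1).choose 2 := by
  let T : (σ × σ → K) →ₗ[K] (Sym σ k × σ × σ → K) := LinearMap.pi fun y =>
    ((y.1 : Multiset σ).map v).prod • LinearMap.proj y.2
  rw [Matrix.rank_eq_finrank_span_row]
  refine le_trans (Submodule.finrank_mono (t := (Submodule.span K (Set.range
    fun x : σ × σ × σ => contraction v x.1 x.2.1 x.2.2)).map T) ?_)
    ((Submodule.finrank_map_le T _).trans (finrank_span_contraction_le v))
  rw [Submodule.span_le]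
  rintro _ ⟨x, rfl⟩
  have hrow : (koszulFlattening k l ((∑ i, v i • X i : MvPolynomial σ K) ^ (k + l + 1))).row x =
      (((k + l + 1).factorial : K) * ((x.1 : Multiset σ).map v).prod) •
        T (contraction v x.2.1 x.2.2.1 x.2.2.2) := by
    ext y
    exact koszulFlattening_linearForm_pow v x y
  rw [hrow]
  exact Submodule.smul_mem _ _ (Submodule.mem_map_of_mem (Submodule.subset_span ⟨x.2, rfl⟩))

theorem matrixRank_add_le {ι κ : Type*} [Finite ι] [Fintype κ] (A B : Matrix ι κ K) :
    (A + B).rank ≤ A.rank + B.rank := by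
  have hle : LinearMap.range (A + B).mulVecLin ≤
      LinearMap.range A.mulVecLin ⊔ LinearMap.range B.mulVecLin := by
    rw [Matrix.mulVecLin_add]
    exact LinearMap.range_add_le _ _
  exact (Submodule.finrank_mono hle).trans (Submodule.finrank_add_le_finrank_add_finrank _ _)

theorem rank_koszulFlattening_sum_pow_le {r : ℕ} (v : Fin r → SymPow σ 1) :
    (koszulFlattening k l (∑ i, (v i : MvPolynomial σ ℂ) ^ (k + l + 1))).rank ≤
      r * (Fintype.card σ - 1).choose 2 := by
  have hpow : ∀ w : SymPow σ 1, (koszulFlattening k l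
      ((w : MvPolynomial σ ℂ) ^ (k + l + 1))).rank ≤ (Fintype.card σ - 1).choose 2 := by
    rintro ⟨w, hw⟩
    rw [SymPow, homogeneousSubmodule_one_eq_span_X,
      Submodule.mem_span_range_iff_exists_fun] at hw
    obtain ⟨c, rfl⟩ := hw
    exact rank_koszulFlattening_linearForm_pow_le c
  induction r with
  | zero => simp
  | succ r ih =>
    rw [Fin.sum_univ_succ, map_add, add_mul, one_mul, add_comm (r * _)]
    exact (matrixRank_add_le _ _).trans (add_le_add (hpow _) (ih _))

end KoszulRank

section Semicontinuity

theorem exists_mul_mul_eq_one {K ι κ : Type*} [Field K] [Fintype ι] [Fintype κ]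
    (M : Matrix ι κ K) :
    ∃ (A : Matrix (Fin M.rank) ι K) (B : Matrix κ (Fin M.rank) K), A * M * B = 1 := by
  classical
  obtain ⟨g, hg⟩ := M.mulVecLin.range.subtype.exists_leftInverse_of_injective
    (Submodule.ker_subtype _)
  obtain ⟨s, hs⟩ := M.mulVecLin.rangeRestrict.exists_rightInverse_of_surjective
    (LinearMap.range_rangeRestrict _)
  let e : M.mulVecLin.range ≃ₗ[K] (Fin M.rank → K) := (Module.finBasis K _).equivFun
  refine ⟨LinearMap.toMatrix' (e.toLinearMap ∘ₗ g), LinearMap.toMatrix' (s ∘ₗ e.symm), ?_⟩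
  have hcomp : ((e.toLinearMap ∘ₗ g) ∘ₗ M.mulVecLin) ∘ₗ (s ∘ₗ e.symm.toLinearMap) =
      LinearMap.id := by
    refine LinearMap.ext fun x => ?_
    have hs' : M.mulVecLin (s (e.symm x)) = M.mulVecLin.range.subtype (e.symm x) :=
      congrArg Subtype.val (LinearMap.congr_fun hs (e.symm x))
    have hg' : g (M.mulVecLin.range.subtype (e.symm x)) = e.symm x := LinearMap.congr_fun hg _
    simp only [LinearMap.comp_apply, LinearEquiv.coe_coe, hs', hg', LinearEquiv.apply_symm_apply,
      LinearMap.id_apply]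
  have hM : LinearMap.toMatrix' M.mulVecLin = M := LinearMap.toMatrix'_toLin' M
  simpa only [LinearMap.toMatrix'_comp, hM, LinearMap.toMatrix'_id] using
    congrArg LinearMap.toMatrix' hcomp

variable {W : Type*} [AddCommGroup W] [Module ℂ W]

theorem det_mem_polyFunctions {r : ℕ} (φ : W →ₗ[ℂ] Matrix (Fin r) (Fin r) ℂ) :
    (fun w => (φ w).det) ∈ polyFunctions W := by
  have hdet : (fun w => (φ w).det) = ∑ τ : Equiv.Perm (Fin r), ((Equiv.Perm.sign τ : ℤ) : ℂ) •
      ∏ i, fun w => φ w (τ i) i := by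
    ext w
    simp [Matrix.det_apply', Finset.sum_apply, Finset.prod_apply]
  rw [hdet]
  exact Subalgebra.sum_mem _ fun τ _ => Subalgebra.smul_mem _
    (Subalgebra.prod_mem _ fun i _ =>
      Algebra.subset_adjoin (Set.mem_range_self (Matrix.entryLinearMap ℂ ℂ (τ i) i ∘ₗ φ))) _

theorem rank_le_of_mem_zariskiClosure {ι κ : Type*} [Finite ι] [Fintype κ]
    (Φ : W →ₗ[ℂ] Matrix ι κ ℂ) {S : Set W} {r : ℕ} (hS : ∀ s ∈ S, (Φ s).rank ≤ r) {w : W}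
    (hw : w ∈ zariskiClosure S) : (Φ w).rank ≤ r := by
  have := Fintype.ofFinite ι
  by_contra! hlt
  obtain ⟨A, B, hAB⟩ := exists_mul_mul_eq_one (Φ w)
  let Ψ : W →ₗ[ℂ] Matrix (Fin (Φ w).rank) (Fin (Φ w).rank) ℂ :=
    { toFun := fun s => A * Φ s * B
      map_add' := fun s t => by rw [map_add, Matrix.mul_add, Matrix.add_mul]
      map_smul' := fun c s => by
        rw [map_smul, Matrix.mul_smul, Matrix.smul_mul, RingHom.id_apply] }
  have hvanish : ∀ s ∈ S, (Ψ s).det = 0 := fun s hs => by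
    by_contra hne
    have hfull : (Ψ s).rank = (Φ w).rank := by
      rw [Matrix.rank_of_det_ne_zero hne, Fintype.card_fin]
    have hle : (Ψ s).rank ≤ (Φ s).rank :=
      ((A * Φ s).rank_mul_le_left B).trans (A.rank_mul_le_right (Φ s))
    exact hlt.not_ge (hfull ▸ hle.trans (hS s hs))
  have hzero : (A * Φ w * B).det = 0 := hw _ (det_mem_polyFunctions Ψ) hvanish
  rw [hAB, Matrix.det_one] at hzero
  exact one_ne_zero hzero

end Semicontinuity

section BorderRank

variable {σ : Type*} {n r : ℕ}

theorem mem_of_sInf_image_natCast_eq {S : Set ℕ}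
    (h : sInf ((fun r : ℕ => (r : ℕ∞)) '' S) = r) : r ∈ S := by
  have hne : ((fun r : ℕ => (r : ℕ∞)) '' S).Nonempty := by
    by_contra hempty
    rw [Set.not_nonempty_iff_eq_empty.1 hempty, sInf_empty] at h
    exact ENat.top_ne_natCast r h
  obtain ⟨s, hs, heq⟩ := csInf_mem hne
  rwa [← Nat.cast_injective (heq.trans h)]

theorem exists_eq_sum_pow_of_symmetricRank_eq {T : SymPow σ n} (h : symmetricRank T = r) :
    ∃ v : Fin r → SymPow σ 1, (T : MvPolynomial σ ℂ) = ∑ i, (v i : MvPolynomial σ ℂ) ^ n :=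
  mem_of_sInf_image_natCast_eq h

theorem mem_zariskiClosure_of_symmetricBorderRank_eq {P : SymPow σ n}
    (h : symmetricBorderRank P = r) :
    P ∈ zariskiClosure {T : SymPow σ n | symmetricRank T = (r : ℕ∞)} :=
  mem_of_sInf_image_natCast_eq h

theorem rank_koszulFlattening_le_of_symmetricBorderRank_eq [Fintype σ] [DecidableEq σ] {k l : ℕ}
    (hn : k + l + 1 = n) {P : SymPow σ n} (hP : symmetricBorderRank P = r) :
    (koszulFlattening k l (P : MvPolynomial σ ℂ)).rank ≤ r * (Fintype.card σ - 1).choose 2 := by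
  subst hn
  refine rank_le_of_mem_zariskiClosure (koszulFlattening k l ∘ₗ (SymPow σ _).subtype)
    (fun T hT => ?_) (mem_zariskiClosure_of_symmetricBorderRank_eq hP)
  obtain ⟨v, hv⟩ := exists_eq_sum_pow_of_symmetricRank_eq hT
  rw [LinearMap.comp_apply, Submodule.subtype_apply, hv]
  exact rank_koszulFlattening_sum_pow_le v

theorem eq_sum_monomial_of_isHomogeneous {R : Type*} [CommSemiring R] [Fintype σ] [DecidableEq σ]
    {P : MvPolynomial σ R} (hP : P.IsHomogeneous n) :
    P = ∑ s ∈ Finset.univ.finsuppAntidiag n, monomial s (coeff s P) := by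
  have hsupp : P.support ⊆ Finset.univ.finsuppAntidiag n := fun s hs => by
    rw [Finset.mem_finsuppAntidiag', ← hP (mem_support_iff.1 hs)]
    simp [Finsupp.weight_apply]
  conv_lhs => rw [P.as_sum]
  refine Finset.sum_subset hsupp fun s _ hs => ?_
  rw [notMem_support_iff.1 hs, monomial_zero]

/-- A functional killing all powers of linear forms is encoded by a polynomial `f` that vanishes
at all points. -/
theorem mem_span_range_linearForm_pow {K : Type*} [Field K] [CharZero K] [Fintype σ]
    {P : MvPolynomial σ K} (hP : P.IsHomogeneous n) :
    P ∈ Submodule.span K (Set.range fun v : σ → K => (∑ i, v i • X i : MvPolynomial σ K) ^ n) := by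
  classical
  by_contra hmem
  obtain ⟨F, hFP, hF⟩ := Submodule.exists_le_ker_of_notMem hmem
  let A : Finset (σ →₀ ℕ) := Finset.univ.finsuppAntidiag n
  have hexpand : ∀ Q : MvPolynomial σ K, Q.IsHomogeneous n →
      F Q = ∑ s ∈ A, coeff s Q * F (monomial s 1) := fun Q hQ => by
    conv_lhs => rw [eq_sum_monomial_of_isHomogeneous hQ, map_sum]
    refine Finset.sum_congr rfl fun s _ => ?_
    rw [← smul_eq_mul, ← map_smul, smul_monomial, smul_eq_mul, mul_one]
  let f : MvPolynomial σ K := ∑ s ∈ A, monomial s ((s.multinomial : K) * F (monomial s 1))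
  have hf : f = 0 := MvPolynomial.funext fun v => by
    have hlin : (∑ i, v i • X i : MvPolynomial σ K).IsHomogeneous 1 :=
      IsHomogeneous.sum _ _ _ fun i _ =>
        (homogeneousSubmodule σ K 1).smul_mem _ (isHomogeneous_X K i)
    have hv : F ((∑ i, v i • X i) ^ n) = 0 := hF (Submodule.subset_span ⟨v, rfl⟩)
    rw [hexpand _ (by simpa using hlin.pow n)] at hv
    rw [map_zero, ← hv, map_sum]
    refine Finset.sum_congr rfl fun s hs => ?_
    rw [eval_monomial, coeff_linearCombination_X_pow_of_fintype,
      if_pos (Finset.mem_finsuppAntidiag'.1 hs).1]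
    ring
  have hmon : ∀ s ∈ A, F (monomial s 1) = 0 := fun s hs => by
    have hcoeff : (s.multinomial : K) * F (monomial s 1) = 0 := by
      simpa [f, coeff_sum, coeff_monomial, hs] using congrArg (coeff s) hf
    exact (mul_eq_zero.1 hcoeff).resolve_left (Nat.cast_ne_zero.2 (Nat.multinomial_pos _ _).ne')
  refine hFP ((hexpand P hP).trans (Finset.sum_eq_zero fun s hs => ?_))
  rw [hmon s hs, mul_zero]

theorem exists_eq_sum_pow [Finite σ] (hn : n ≠ 0) (P : SymPow σ n) :
    ∃ (r : ℕ) (v : Fin r → SymPow σ 1),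
      (P : MvPolynomial σ ℂ) = ∑ i, (v i : MvPolynomial σ ℂ) ^ n := by
  have := Fintype.ofFinite σ
  obtain ⟨r, c, g, hsum⟩ := Submodule.mem_span_set'.1 (mem_span_range_linearForm_pow P.2)
  choose v hv using fun i => (g i).2
  choose z hz using fun i => IsAlgClosed.exists_pow_nat_eq (c i) (Nat.pos_of_ne_zero hn)
  have hlin : ∀ i, (∑ j, v i j • X j : MvPolynomial σ ℂ) ∈ SymPow σ 1 := fun i =>
    Submodule.sum_mem _ fun j _ => Submodule.smul_mem _ _ (isHomogeneous_X ℂ j)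
  refine ⟨r, fun i => z i • ⟨_, hlin i⟩, ?_⟩
  rw [← hsum]
  refine Finset.sum_congr rfl fun i _ => ?_
  rw [← hv i, SetLike.val_smul, smul_pow, hz i]

theorem exists_symmetricBorderRank_eq [Finite σ] (hn : n ≠ 0) (P : SymPow σ n) :
    ∃ r : ℕ, symmetricBorderRank P = r := by
  obtain ⟨r, v, hv⟩ := exists_eq_sum_pow hn P
  have hrank : symmetricRank P ≠ ⊤ :=
    ne_top_of_le_ne_top (ENat.natCast_ne_top r) (sInf_le ⟨r, ⟨v, hv⟩, rfl⟩)
  obtain ⟨s, hs⟩ := ENat.ne_top_iff_exists.1 hrank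
  have hborder : symmetricBorderRank P ≠ ⊤ :=
    ne_top_of_le_ne_top (ENat.natCast_ne_top s) (sInf_le ⟨s, fun F _ hF => hF P hs.symm, rfl⟩)
  obtain ⟨t, ht⟩ := ENat.ne_top_iff_exists.1 hborder
  exact ⟨t, ht.symm⟩

end BorderRank

section Determinant

variable {ι R : Type*} [Fintype ι]

/-- The graph of the permutation `τ`, as the multiset of cells `(τ j, j)`: the monomials of the
generic determinant. -/
def permGraph (τ : Equiv.Perm ι) : Multiset (ι × ι) :=
  (Finset.univ : Finset ι).val.map fun j => (τ j, j)

theorem nodup_permGraph (τ : Equiv.Perm ι) : (permGraph τ).Nodup :=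
  Finset.univ.nodup.map fun _ _ h => congrArg Prod.snd h

theorem mem_permGraph {τ : Equiv.Perm ι} {c : ι × ι} : c ∈ permGraph τ ↔ τ c.2 = c.1 := by
  rw [permGraph, Multiset.mem_map]
  exact ⟨fun ⟨j, _, hj⟩ => hj ▸ rfl, fun h => ⟨c.2, Finset.mem_univ _, Prod.ext h rfl⟩⟩

theorem permGraph_injective : Function.Injective (permGraph : Equiv.Perm ι → _) := fun τ ρ h => by
  ext j : 1
  exact (mem_permGraph (c := (τ j, j)).1 (h ▸ mem_permGraph.2 rfl)).symm

theorem map_snd_permGraph (τ : Equiv.Perm ι) :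
    (permGraph τ).map Prod.snd = (Finset.univ : Finset ι).val := by
  simp [permGraph]

theorem map_fst_permGraph (τ : Equiv.Perm ι) :
    (permGraph τ).map Prod.fst = (Finset.univ : Finset ι).val := by
  have h : (permGraph τ).map Prod.fst = ((Finset.univ : Finset ι).map τ.toEmbedding).val := by
    simp [permGraph]
  rw [h, Finset.map_univ_equiv]

theorem exists_eq_permGraph_iff {m : Multiset (ι × ι)} :
    (∃ τ, m = permGraph τ) ↔
      m.map Prod.fst = (Finset.univ : Finset ι).val ∧
        m.map Prod.snd = (Finset.univ : Finset ι).val := by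
  refine ⟨?_, fun ⟨hfst, hsnd⟩ => ?_⟩
  · rintro ⟨τ, rfl⟩
    exact ⟨map_fst_permGraph τ, map_snd_permGraph τ⟩
  have hinj := Multiset.inj_on_of_nodup_map (hsnd ▸ Finset.univ.nodup)
  have hex : ∀ j, ∃ i, (i, j) ∈ m := fun j => by
    obtain ⟨c, hc, rfl⟩ := Multiset.mem_map.1 (hsnd ▸ Finset.mem_univ_val j)
    exact ⟨c.1, hc⟩
  choose f hf using hex
  have hm : m = Finset.univ.val.map fun j => (f j, j) := by
    refine (Multiset.Nodup.ext (.of_map Prod.snd (hsnd ▸ Finset.univ.nodup))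
      (Finset.univ.nodup.map fun _ _ h => congrArg Prod.snd h)).2 fun c => ?_
    rw [Multiset.mem_map]
    refine ⟨fun hc => ⟨c.2, Finset.mem_univ_val _, hinj _ (hf c.2) c hc rfl⟩, ?_⟩
    rintro ⟨j, -, rfl⟩
    exact hf j
  have hsurj : Function.Surjective f := fun i => by
    obtain ⟨c, hc, rfl⟩ := Multiset.mem_map.1 (hfst ▸ Finset.mem_univ_val i)
    exact ⟨c.2, congrArg Prod.fst (hinj _ (hf c.2) c hc rfl)⟩
  exact ⟨Equiv.ofBijective f (Finite.surjective_iff_bijective.1 hsurj), hm⟩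

variable [DecidableEq ι] [CommRing R]

theorem derivAtZero_det (m : Multiset (ι × ι)) :
    derivAtZero m (Matrix.mvPolynomialX ι ι R).det =
      ∑ τ : Equiv.Perm ι, ((Equiv.Perm.sign τ : ℤ) : R) * if m = permGraph τ then 1 else 0 := by
  have hprod : ∀ τ : Equiv.Perm ι, ∏ j, (X (τ j, j) : MvPolynomial (ι × ι) R) =
      monomial (Multiset.toFinsupp (permGraph τ)) 1 := fun τ => by
    have : Multiset.toFinsupp (permGraph τ) = ∑ j, Finsupp.single (τ j, j) 1 := by
      rw [permGraph, ← Multiset.sum_map_singleton (Multiset.map _ _), Multiset.map_map]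
      exact (map_sum Multiset.toFinsupp _ _).trans (by simp)
    rw [this, monomial_sum_one]
    rfl
  rw [Matrix.det_apply', map_sum]
  refine Finset.sum_congr rfl fun τ _ => ?_
  simp only [Matrix.mvPolynomialX_apply]
  rw [hprod, ← zsmul_eq_mul, map_zsmul, zsmul_eq_mul, derivAtZero_apply, coeff_monomial]
  congr 1
  by_cases h : m = permGraph τ
  · have hfac : (Multiset.toFinsupp m).prod (fun _ k => k.factorial) = 1 :=
      Finset.prod_eq_one fun c _ => by
        rw [Multiset.toFinsupp_apply, Nat.factorial_eq_one]
        exact Multiset.nodup_iff_count_le_one.1 (h ▸ nodup_permGraph τ) c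
    rw [if_pos h, hfac, if_pos (h ▸ rfl), Nat.cast_one, one_mul]
  · rw [if_neg h, if_neg fun e => h (Multiset.toFinsupp.injective e).symm, mul_zero]

theorem derivAtZero_det_permGraph (τ : Equiv.Perm ι) :
    derivAtZero (permGraph τ) (Matrix.mvPolynomialX ι ι R).det = (Equiv.Perm.sign τ : ℤ) := by
  rw [derivAtZero_det, Finset.sum_eq_single τ]
  · simp
  · intro ρ _ hρ
    rw [if_neg fun h => hρ (permGraph_injective h).symm, mul_zero]
  · simp

theorem derivAtZero_det_eq_zero {m : Multiset (ι × ι)} (h : ∀ τ, m ≠ permGraph τ) :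
    derivAtZero m (Matrix.mvPolynomialX ι ι R).det = 0 := by
  rw [derivAtZero_det]
  exact Finset.sum_eq_zero fun τ _ => by rw [if_neg (h τ), mul_zero]

theorem derivAtZero_det_cons_cons_eq_zero {p q : ι × ι} (h : p.1 = q.1 ∨ p.2 = q.2)
    (m : Multiset (ι × ι)) :
    derivAtZero (p ::ₘ q ::ₘ m) (Matrix.mvPolynomialX ι ι R).det = 0 := by
  refine derivAtZero_det_eq_zero fun τ hτ => ?_
  have hp : τ p.2 = p.1 := mem_permGraph.1 (hτ ▸ Multiset.mem_cons_self _ _)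
  have hq : τ q.2 = q.1 := mem_permGraph.1 (hτ ▸ by simp)
  have hpq : p ≠ q := fun e => by
    have := nodup_permGraph τ
    rw [← hτ, e] at this
    exact (Multiset.nodup_cons.1 this).1 (Multiset.mem_cons_self _ _)
  rcases h with h | h
  · exact hpq (Prod.ext h (τ.injective (by rw [hp, hq, h])))
  · exact hpq (Prod.ext (by rw [← hp, ← hq, h]) h)

theorem permGraph_eq_cons_cons (τ : Equiv.Perm ι) {i j : ι} (h : i ≠ j) :
    permGraph τ = (τ i, i) ::ₘ (τ j, j) ::ₘ
      ((Finset.univ.erase i).erase j).val.map fun s => (τ s, s) := by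
  have hj : j ∈ Finset.univ.val.erase i := (Multiset.mem_erase_of_ne h.symm).2 (Finset.mem_univ j)
  rw [← Multiset.map_cons (fun s => (τ s, s)), ← Multiset.map_cons (fun s => (τ s, s)),
    Finset.erase_val, Finset.erase_val, Multiset.cons_erase hj,
    Multiset.cons_erase (Finset.mem_univ i), permGraph]

theorem permGraph_mul_swap_eq {p q : ι × ι} (h : p.2 ≠ q.2) {m : Multiset (ι × ι)}
    {τ : Equiv.Perm ι} (hτ : permGraph τ = p ::ₘ q ::ₘ m) :
    permGraph (τ * Equiv.swap p.2 q.2) = (q.1, p.2) ::ₘ (p.1, q.2) ::ₘ m := by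
  have hp : τ p.2 = p.1 := mem_permGraph.1 (hτ ▸ Multiset.mem_cons_self _ _)
  have hq : τ q.2 = q.1 := mem_permGraph.1 (hτ ▸ by simp)
  have hm : m = ((Finset.univ.erase p.2).erase q.2).val.map fun s => (τ s, s) := by
    rw [permGraph_eq_cons_cons τ h, hp, hq] at hτ
    exact ((Multiset.cons_inj_right _).1 ((Multiset.cons_inj_right _).1 hτ)).symm
  rw [permGraph_eq_cons_cons _ h, hm, Equiv.Perm.mul_apply, Equiv.swap_apply_left, hq,
    Equiv.Perm.mul_apply, Equiv.swap_apply_right, hp]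
  congr 2
  refine Multiset.map_congr rfl fun s hs => ?_
  simp only [Finset.mem_val, Finset.mem_erase] at hs
  rw [Equiv.Perm.mul_apply, Equiv.swap_apply_of_ne_of_ne hs.2.1 hs.1]

theorem derivAtZero_det_exchange {p q : ι × ι} (h : p.2 ≠ q.2) (m : Multiset (ι × ι)) :
    derivAtZero (p ::ₘ q ::ₘ m) (Matrix.mvPolynomialX ι ι R).det =
      -derivAtZero ((q.1, p.2) ::ₘ (p.1, q.2) ::ₘ m) (Matrix.mvPolynomialX ι ι R).det := by
  have hiff : ∀ τ : Equiv.Perm ι, p ::ₘ q ::ₘ m = permGraph τ ↔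
      (q.1, p.2) ::ₘ (p.1, q.2) ::ₘ m = permGraph (τ * Equiv.swap p.2 q.2) := fun τ => by
    refine ⟨fun hτ => (permGraph_mul_swap_eq h hτ.symm).symm, fun hτ => ?_⟩
    have hswap := permGraph_mul_swap_eq (p := (q.1, p.2)) (q := (p.1, q.2)) h hτ.symm
    simpa [mul_assoc] using hswap.symm
  rw [derivAtZero_det, derivAtZero_det, ← Finset.sum_neg_distrib]
  refine Fintype.sum_equiv (Equiv.mulRight (Equiv.swap p.2 q.2)) _ _ fun τ => ?_
  rw [Equiv.coe_mulRight, Equiv.Perm.sign_mul, Equiv.Perm.sign_swap h, if_congr (hiff τ) rfl rfl]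
  split_ifs <;> simp

end Determinant

section StrictChain

open Relation

variable {σ : Type*} {r : σ → σ → Prop}

/-- A finite chain of the strict order `r`, as a multiset of pairwise comparable elements; since
`r` is irreflexive, it has no repeated elements. -/
def IsStrictChain (r : σ → σ → Prop) (S : Multiset σ) : Prop :=
  ∀ a b T, S = a ::ₘ b ::ₘ T → SymmGen r a b

/-- The element `b` is not comparable to some element of `S`. -/
def Conflicts (r : σ → σ → Prop) (b : σ) (S : Multiset σ) : Prop :=
  ∃ d ∈ S, ¬SymmGen r b d

theorem Conflicts.cons {b : σ} {S : Multiset σ} (h : Conflicts r b S) (a : σ) :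
    Conflicts r b (a ::ₘ S) :=
  let ⟨d, hd, hbd⟩ := h
  ⟨d, Multiset.mem_cons_of_mem hd, hbd⟩

theorem not_conflicts_iff {b : σ} {S : Multiset σ} :
    ¬Conflicts r b S ↔ ∀ d ∈ S, SymmGen r b d := by
  simp [Conflicts]

theorem conflicts_cons_of_not_symmGen {a b : σ} (h : ¬SymmGen r b a) (S : Multiset σ) :
    Conflicts r b (a ::ₘ S) :=
  ⟨a, Multiset.mem_cons_self a S, h⟩

theorem isStrictChain_cons {a : σ} {S : Multiset σ} :
    IsStrictChain r (a ::ₘ S) ↔ ¬Conflicts r a S ∧ IsStrictChain r S := by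
  rw [not_conflicts_iff]
  constructor
  · refine fun h => ⟨fun d hd => ?_, fun p q T hS => ?_⟩
    · obtain ⟨T, rfl⟩ := Multiset.exists_cons_of_mem hd
      exact h a d T rfl
    · exact h p q (a ::ₘ T) (by simp only [hS, Multiset.cons_swap a])
  · rintro ⟨ha, hS⟩ p q T h
    rcases Multiset.cons_eq_cons.1 h with ⟨rfl, rfl⟩ | ⟨-, U, rfl, hU⟩
    · exact ha q (Multiset.mem_cons_self q T)
    · rcases Multiset.cons_eq_cons.1 hU with ⟨rfl, rfl⟩ | ⟨-, W, rfl, rfl⟩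
      · exact (ha p (Multiset.mem_cons_self p _)).symm
      · exact hS p q W rfl

theorem IsStrictChain.exists_least [IsTrans σ r] {S : Multiset σ} (hS : IsStrictChain r S)
    (hne : S ≠ 0) : ∃ f T, S = f ::ₘ T ∧ ∀ e ∈ T, r f e := by
  induction S using Multiset.induction_on with
  | empty => exact absurd rfl hne
  | cons a S ih =>
    obtain ⟨ha, hS⟩ := isStrictChain_cons.1 hS
    rcases eq_or_ne S 0 with rfl | hS0
    · exact ⟨a, 0, rfl, by simp⟩
    obtain ⟨f, T, rfl, hf⟩ := ih hS hS0
    rcases not_conflicts_iff.1 ha f (Multiset.mem_cons_self f T) with haf | hfa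
    · refine ⟨a, f ::ₘ T, rfl, Multiset.forall_mem_cons.2 ⟨haf, fun e he => ?_⟩⟩
      exact trans_of r haf (hf e he)
    · exact ⟨f, a ::ₘ T, Multiset.cons_swap a f T, Multiset.forall_mem_cons.2 ⟨hfa, hf⟩⟩

theorem exists_eq_cons_of_conflicts_of_conflicts {S : Multiset σ} (hS : 3 ≤ S.card) {a b : σ}
    (ha : Conflicts r a S) (hb : Conflicts r b S) :
    ∃ c D, S = c ::ₘ D ∧ Conflicts r a D ∧ Conflicts r b D := by
  obtain ⟨d, hd, had⟩ := ha
  obtain ⟨e, he, hbe⟩ := hb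
  obtain ⟨T, rfl⟩ := Multiset.exists_cons_of_mem hd
  rcases Multiset.mem_cons.1 he with rfl | heT
  · obtain ⟨c, hc⟩ := Multiset.card_pos_iff_exists_mem.1
      (by rw [Multiset.card_cons] at hS; omega : 0 < T.card)
    obtain ⟨U, rfl⟩ := Multiset.exists_cons_of_mem hc
    exact ⟨c, e ::ₘ U, Multiset.cons_swap e c U, conflicts_cons_of_not_symmGen had U,
      conflicts_cons_of_not_symmGen hbe U⟩
  · obtain ⟨U, rfl⟩ := Multiset.exists_cons_of_mem heT
    obtain ⟨c, hc⟩ := Multiset.card_pos_iff_exists_mem.1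
      (by simp only [Multiset.card_cons] at hS; omega : 0 < U.card)
    obtain ⟨W, rfl⟩ := Multiset.exists_cons_of_mem hc
    refine ⟨c, d ::ₘ e ::ₘ W, ?_, conflicts_cons_of_not_symmGen had _,
      (conflicts_cons_of_not_symmGen hbe W).cons d⟩
    rw [Multiset.cons_swap e c W, Multiset.cons_swap d c]

/-- The cell `a` of the chain `a ::ₘ D` may be moved next to `b` to obtain a normal form of the
brackets of `a ::ₘ D` and `b`. -/
def IsPivot (r : σ → σ → Prop) (b a : σ) (D : Multiset σ) : Prop :=
  Conflicts r b D ∨ ¬Conflicts r b (a ::ₘ D) ∧ ∀ e ∈ D, r a e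

theorem IsStrictChain.exists_isPivot [IsTrans σ r] {E : Multiset σ} (hE : IsStrictChain r E)
    (hcard : 2 ≤ E.card) (b : σ) : ∃ a D, E = a ::ₘ D ∧ IsPivot r b a D := by
  by_cases h : Conflicts r b E
  · obtain ⟨d, hd, hbd⟩ := h
    obtain ⟨T, rfl⟩ := Multiset.exists_cons_of_mem hd
    obtain ⟨a, ha⟩ := Multiset.card_pos_iff_exists_mem.1
      (by rw [Multiset.card_cons] at hcard; omega : 0 < T.card)
    obtain ⟨U, rfl⟩ := Multiset.exists_cons_of_mem ha
    exact ⟨a, d ::ₘ U, Multiset.cons_swap d a U, .inl (conflicts_cons_of_not_symmGen hbd U)⟩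
  · obtain ⟨a, D, rfl, ha⟩ := hE.exists_least (Multiset.card_pos.1 (by omega))
    exact ⟨a, D, rfl, .inr ⟨h, ha⟩⟩

end StrictChain

section Straightening

open Relation

variable {σ M : Type*} [AddCommGroup M]

/-- The relations between the brackets `β m a b` of multidegree `μ = a ::ₘ b ::ₘ m` modulo the
Koszul relations, the brackets of smaller weight and the normal forms: a bracket with two
incomparable cells in `m` can be straightened, and the bracket of every chain `E` and cell `b` with
a suitable pivot vanishes, unless `b` precedes all of `E`. -/
structure StraighteningRelations (r : σ → σ → Prop) (β : Multiset σ → σ → σ → M)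
    (μ : Multiset σ) : Prop where
  swap : ∀ m a b, β m a b = -β m b a
  koszul : ∀ D a b c, a ::ₘ b ::ₘ c ::ₘ D = μ →
    β (a ::ₘ D) b c - β (b ::ₘ D) a c + β (c ::ₘ D) a b = 0
  straighten : ∀ m p q a b, ¬SymmGen r p q → a ::ₘ b ::ₘ p ::ₘ q ::ₘ m = μ →
    β (p ::ₘ q ::ₘ m) a b = 0
  pivot : ∀ E b, b ::ₘ E = μ → IsStrictChain r E → (¬∀ e ∈ E, r b e) →
    ∃ a D, E = a ::ₘ D ∧ IsPivot r b a D ∧ β D a b = 0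

namespace StraighteningRelations

variable {r : σ → σ → Prop} {β : Multiset σ → σ → σ → M} {μ : Multiset σ}

theorem eq_zero_of_not_isStrictChain (h : StraighteningRelations r β μ) {S : Multiset σ} {a b : σ}
    (hμ : a ::ₘ b ::ₘ S = μ) (hS : ¬IsStrictChain r S) : β S a b = 0 := by
  simp only [IsStrictChain, not_forall] at hS
  obtain ⟨p, q, T, rfl, hpq⟩ := hS
  exact h.straighten T p q a b hpq hμ

theorem eq_zero_of_conflicts (h : StraighteningRelations r β μ) {D : Multiset σ} {a b c : σ}
    (hμ : a ::ₘ b ::ₘ c ::ₘ D = μ) (hc : Conflicts r c D) : β (c ::ₘ D) a b = 0 :=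
  h.eq_zero_of_not_isStrictChain hμ fun hS => (isStrictChain_cons.1 hS).1 hc

theorem eq_zero_of_conflicts_of_conflicts (h : StraighteningRelations r β μ) {S : Multiset σ}
    (hcard : 3 ≤ S.card) {a b : σ} (hμ : a ::ₘ b ::ₘ S = μ) (ha : Conflicts r a S)
    (hb : Conflicts r b S) : β S a b = 0 := by
  obtain ⟨c, D, rfl, ha, hb⟩ := exists_eq_cons_of_conflicts_of_conflicts hcard ha hb
  have hab := h.eq_zero_of_conflicts (a := b) (b := c) (by simp [← hμ, Multiset.cons_swap]) ha
  have hba := h.eq_zero_of_conflicts (a := a) (b := c) (by simp [← hμ, Multiset.cons_swap]) hb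
  simpa [hab, hba] using h.koszul D a b c hμ

theorem exchange_of_conflicts (h : StraighteningRelations r β μ) {D : Multiset σ} {a a' b : σ}
    (hμ : b ::ₘ a ::ₘ a' ::ₘ D = μ) (hb : Conflicts r b D) :
    β (a' ::ₘ D) a b = β (a ::ₘ D) a' b := by
  have hD := h.eq_zero_of_conflicts (a := a) (b := a') (by simp [← hμ, Multiset.cons_swap]) hb
  have hK := h.koszul D a a' b (by simp [← hμ, Multiset.cons_swap])
  rw [hD, add_zero, sub_eq_zero] at hK
  exact hK.symm

theorem exchange_of_conflicts_cons (h : StraighteningRelations r β μ) {D : Multiset σ}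
    (hD : D ≠ 0) {a a' b : σ} (hμ : b ::ₘ a ::ₘ a' ::ₘ D = μ) (hb : Conflicts r b (a ::ₘ D))
    (hb' : Conflicts r b (a' ::ₘ D)) : β (a' ::ₘ D) a b = β (a ::ₘ D) a' b := by
  by_cases hbD : Conflicts r b D
  · exact h.exchange_of_conflicts hμ hbD
  have hnot : ∀ {c}, Conflicts r b (c ::ₘ D) → ¬SymmGen r b c := by
    rintro c ⟨d, hd, hbd⟩
    rcases Multiset.mem_cons.1 hd with rfl | hd
    · exact hbd
    · exact absurd ⟨d, hd, hbd⟩ hbD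
  obtain ⟨e, he⟩ := Multiset.exists_mem_of_ne_zero hD
  obtain ⟨U, rfl⟩ := Multiset.exists_cons_of_mem he
  have hae := h.exchange_of_conflicts (D := a' ::ₘ U) (a := a) (a' := e) (b := b)
    (by simp [← hμ, Multiset.cons_swap]) (conflicts_cons_of_not_symmGen (hnot hb') U)
  have hea' := h.exchange_of_conflicts (D := a ::ₘ U) (a := e) (a' := a') (b := b)
    (by simp [← hμ, Multiset.cons_swap]) (conflicts_cons_of_not_symmGen (hnot hb) U)
  calc β (a' ::ₘ e ::ₘ U) a b = β (a ::ₘ a' ::ₘ U) e b := by rw [Multiset.cons_swap, hae]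
    _ = β (a ::ₘ e ::ₘ U) a' b := by rw [Multiset.cons_swap, hea', Multiset.cons_swap]

theorem eq_zero_of_isStrictChain_cons_of_conflicts (h : StraighteningRelations r β μ)
    {D : Multiset σ} (hcard : 2 ≤ D.card) {a b : σ} (hμ : b ::ₘ a ::ₘ D = μ)
    (hE : IsStrictChain r (a ::ₘ D)) (hb : Conflicts r b D) : β D a b = 0 := by
  obtain ⟨a₀, D₀, hED, hpivot, hzero⟩ := h.pivot (a ::ₘ D) b hμ hE fun hlt =>
    let ⟨d, hd, hbd⟩ := hb
    hbd (.inl (hlt d (Multiset.mem_cons_of_mem hd)))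
  have hb₀ : Conflicts r b D₀ := hpivot.resolve_right fun hnc => hnc.1 (hED ▸ hb.cons a)
  rcases Multiset.cons_eq_cons.1 hED with ⟨rfl, rfl⟩ | ⟨-, U, rfl, rfl⟩
  · exact hzero
  · have hU : U ≠ 0 := by
      rintro rfl
      simp at hcard
    rw [h.exchange_of_conflicts_cons hU hμ hb₀ hb, hzero]

theorem eq_zero_of_not_symmGen (h : StraighteningRelations r β μ) {S : Multiset σ}
    (hcard : 2 ≤ S.card) {a b : σ} (hμ : a ::ₘ b ::ₘ S = μ) (ha : IsStrictChain r (a ::ₘ S))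
    (hb : IsStrictChain r (b ::ₘ S)) (hab : ¬SymmGen r a b) : β S a b = 0 := by
  obtain ⟨e, he⟩ := Multiset.card_pos_iff_exists_mem.1 (by omega : 0 < S.card)
  obtain ⟨D, rfl⟩ := Multiset.exists_cons_of_mem he
  have hD : ∀ c : σ, 2 ≤ (c ::ₘ D).card := fun c => by simpa using hcard
  have hae : β (a ::ₘ D) b e = 0 := by
    rw [h.swap, h.eq_zero_of_isStrictChain_cons_of_conflicts (hD a)
      (by simp [← hμ, Multiset.cons_swap]) (by rwa [Multiset.cons_swap])
      (conflicts_cons_of_not_symmGen (fun hba => hab hba.symm) D), neg_zero]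
  have hbe : β (b ::ₘ D) a e = 0 := by
    rw [h.swap, h.eq_zero_of_isStrictChain_cons_of_conflicts (hD b)
      (by simp [← hμ, Multiset.cons_swap]) (by rwa [Multiset.cons_swap])
      (conflicts_cons_of_not_symmGen hab D), neg_zero]
  simpa [hae, hbe] using h.koszul D a b e hμ

theorem eq_zero_of_least [Std.Asymm r] (h : StraighteningRelations r β μ) {D : Multiset σ}
    {f b : σ} (hμ : f ::ₘ b ::ₘ D = μ) (hchain : IsStrictChain r (f ::ₘ b ::ₘ D))
    (hf : ∀ e ∈ b ::ₘ D, r f e) : β D f b = 0 := by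
  rw [Multiset.cons_swap, isStrictChain_cons] at hchain
  obtain ⟨a, E, hE, hpivot, hzero⟩ := h.pivot (f ::ₘ D) b (by rw [Multiset.cons_swap, hμ])
    hchain.2 fun hlt => asymm_of r (hf b (Multiset.mem_cons_self b D))
      (hlt f (Multiset.mem_cons_self f D))
  rcases hpivot with hb | ⟨-, ha⟩
  · exact absurd (hE ▸ hb.cons a) hchain.1
  rcases Multiset.cons_eq_cons.1 hE with ⟨rfl, rfl⟩ | ⟨-, U, rfl, rfl⟩
  · exact hzero
  · exact absurd (ha f (Multiset.mem_cons_self f U)) (asymm_of r (hf a (by simp)))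

theorem eq_zero_of_isStrictChain [IsStrictOrder σ r] (h : StraighteningRelations r β μ)
    {S : Multiset σ} {a b : σ} (hμ : a ::ₘ b ::ₘ S = μ)
    (hchain : IsStrictChain r (a ::ₘ b ::ₘ S)) : β S a b = 0 := by
  obtain ⟨f, T, hT, hf⟩ := hchain.exists_least (Multiset.cons_ne_zero)
  rcases Multiset.cons_eq_cons.1 hT with ⟨rfl, rfl⟩ | ⟨-, U, hU, rfl⟩
  · exact h.eq_zero_of_least hμ hchain hf
  rcases Multiset.cons_eq_cons.1 hU with ⟨rfl, rfl⟩ | ⟨-, D, rfl, rfl⟩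
  · rw [Multiset.cons_swap] at hμ hchain
    rw [h.swap, h.eq_zero_of_least hμ hchain hf, neg_zero]
  · have hμ' : f ::ₘ a ::ₘ b ::ₘ D = μ := by rw [← hT, hμ]
    have hlow : ∀ {c d : σ}, a ::ₘ b ::ₘ D = c ::ₘ d ::ₘ D → β (d ::ₘ D) f c = 0 := by
      intro c d hcd
      rw [hcd] at hμ' hT hf
      exact h.eq_zero_of_least hμ' (hT ▸ hchain) hf
    simpa [hlow rfl, hlow (Multiset.cons_swap a b D)] using h.koszul D f a b hμ'

theorem eq_zero_of_not_conflicts [IsStrictOrder σ r] (h : StraighteningRelations r β μ)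
    {S : Multiset σ} (hcard : 2 ≤ S.card) {a b : σ} (hμ : a ::ₘ b ::ₘ S = μ)
    (ha : IsStrictChain r (a ::ₘ S)) : β S a b = 0 := by
  by_cases hb : Conflicts r b S
  · exact h.eq_zero_of_isStrictChain_cons_of_conflicts hcard (by rw [Multiset.cons_swap, hμ]) ha hb
  have hbS : IsStrictChain r (b ::ₘ S) := isStrictChain_cons.2 ⟨hb, (isStrictChain_cons.1 ha).2⟩
  by_cases hab : SymmGen r a b
  · refine h.eq_zero_of_isStrictChain hμ (isStrictChain_cons.2 ⟨?_, hbS⟩)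
    rw [not_conflicts_iff, Multiset.forall_mem_cons]
    exact ⟨hab, not_conflicts_iff.1 (isStrictChain_cons.1 ha).1⟩
  · exact h.eq_zero_of_not_symmGen hcard hμ ha hbS hab

theorem eq_zero [IsStrictOrder σ r] (h : StraighteningRelations r β μ) {S : Multiset σ}
    (hcard : 3 ≤ S.card) {a b : σ} (hμ : a ::ₘ b ::ₘ S = μ) : β S a b = 0 := by
  by_cases hS : IsStrictChain r S
  swap
  · exact h.eq_zero_of_not_isStrictChain hμ hS
  by_cases ha : Conflicts r a S
  · by_cases hb : Conflicts r b S
    · exact h.eq_zero_of_conflicts_of_conflicts hcard hμ ha hb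
    · rw [Multiset.cons_swap] at hμ
      rw [h.swap, h.eq_zero_of_not_conflicts (by omega) hμ (isStrictChain_cons.2 ⟨hb, hS⟩),
        neg_zero]
  · exact h.eq_zero_of_not_conflicts (by omega) hμ (isStrictChain_cons.2 ⟨ha, hS⟩)

end StraighteningRelations

end Straightening

section CellOrder

variable {α β : Type*} [LinearOrder α] [LinearOrder β]

/-- The order on the cells of a matrix in which `a` precedes `b` if it lies strictly above and
strictly to the left of `b`. -/
def CellLT (a b : α × β) : Prop :=
  a.1 < b.1 ∧ a.2 < b.2

instance : IsStrictOrder (α × β) CellLT where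
  irrefl _ h := lt_irrefl _ h.1
  trans _ _ _ h h' := ⟨h.1.trans h'.1, h.2.trans h'.2⟩

end CellOrder

section DeterminantBrackets

open Relation

variable {n : ℕ}

/-- A weight of cells that decreases when two incomparable cells in different rows and columns are
replaced by the other two corners of the rectangle they span. -/
def cellWeight (c : Fin n × Fin n) : ℕ :=
  c.1.val * c.2.rev.val

theorem cellWeight_exchange_lt {p q : Fin n × Fin n} (hrow : p.1 ≠ q.1) (hcol : p.2 ≠ q.2)
    (hpq : ¬SymmGen CellLT p q) :
    cellWeight (q.1, p.2) + cellWeight (p.1, q.2) < cellWeight p + cellWeight q := by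
  simp only [SymmGen, CellLT, not_or, not_and, not_lt] at hpq
  simp only [cellWeight]
  rcases lt_or_gt_of_ne hrow with h | h
  · have hrev := Fin.rev_lt_rev.2 ((hpq.1 h).lt_of_ne hcol.symm)
    have := mul_add_mul_lt_mul_add_mul (R := ℕ) h hrev
    omega
  · have hrev := Fin.rev_lt_rev.2 ((hpq.2 h).lt_of_ne hcol)
    have := mul_add_mul_lt_mul_add_mul (R := ℕ) h hrev
    omega

variable {R : Type*} [CommRing R] {k : ℕ}

theorem bracket_det_eq_zero {p q : Fin n × Fin n} (h : p.1 = q.1 ∨ p.2 = q.2)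
    (m : Multiset (Fin n × Fin n)) (a b : Fin n × Fin n) :
    bracket k (Matrix.mvPolynomialX (Fin n) (Fin n) R).det (p ::ₘ q ::ₘ m) a b = 0 := by
  ext y
  simp [bracket, Multiset.add_cons, derivAtZero_det_cons_cons_eq_zero h]

theorem bracket_det_exchange {p q : Fin n × Fin n} (h : p.2 ≠ q.2)
    (m : Multiset (Fin n × Fin n)) (a b : Fin n × Fin n) :
    bracket k (Matrix.mvPolynomialX (Fin n) (Fin n) R).det (p ::ₘ q ::ₘ m) a b =
      -bracket k (Matrix.mvPolynomialX (Fin n) (Fin n) R).det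
        ((q.1, p.2) ::ₘ (p.1, q.2) ::ₘ m) a b := by
  ext y
  simp [bracket, Multiset.add_cons, derivAtZero_det_exchange h]

variable {l : ℕ} {Z : Submodule R (Sym (Fin n × Fin n) k × (Fin n × Fin n) × (Fin n × Fin n) → R)}

theorem bracket_det_mem_of_pivots (hl : 2 ≤ l)
    (hrow : ∀ x, (koszulFlattening k l (Matrix.mvPolynomialX (Fin n) (Fin n) R).det).row x ∈ Z)
    (hpivot : ∀ E b, E.card = l + 2 → IsStrictChain CellLT E → (¬∀ e ∈ E, CellLT b e) →
      ∃ a D, E = a ::ₘ D ∧ IsPivot CellLT b a D ∧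
        bracket k (Matrix.mvPolynomialX (Fin n) (Fin n) R).det D a b ∈ Z)
    (S : Multiset (Fin n × Fin n)) (hS : S.card = l + 1) (a b : Fin n × Fin n) :
    bracket k (Matrix.mvPolynomialX (Fin n) (Fin n) R).det S a b ∈ Z := by
  induction hw : ((a ::ₘ b ::ₘ S).map cellWeight).sum using Nat.strong_induction_on
    generalizing S a b with
  | h w ih =>
  have hcard : ∀ {T : Multiset (Fin n × Fin n)}, T = a ::ₘ b ::ₘ S → T.card = l + 3 := by
    rintro T rfl
    simp [hS]
  have hrel : StraighteningRelations CellLT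
      (fun m a b => Z.mkQ (bracket k (Matrix.mvPolynomialX (Fin n) (Fin n) R).det m a b))
      (a ::ₘ b ::ₘ S) := by
    refine ⟨fun m a b => ?_, fun D a b c hμ => ?_, fun m p q a b hpq hμ => ?_,
      fun E b hμ hE hb => ?_⟩
    · rw [bracket_swap, map_neg]
    · have hD : D.card = l := by simpa using hcard hμ
      rw [← map_sub, ← map_add, Submodule.mkQ_apply, Submodule.Quotient.mk_eq_zero]
      exact hrow (⟨D, hD⟩, a, b, c)
    · rw [Submodule.mkQ_apply, Submodule.Quotient.mk_eq_zero]
      by_cases hline : p.1 = q.1 ∨ p.2 = q.2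
      · rw [bracket_det_eq_zero hline]
        exact Z.zero_mem
      obtain ⟨hr, hc⟩ := not_or.1 hline
      have hlt := cellWeight_exchange_lt hr hc hpq
      rw [bracket_det_exchange hc]
      refine Z.neg_mem (ih _ ?_ _ (by simpa using hcard hμ) a b rfl)
      rw [← hw, ← hμ]
      simp only [Multiset.map_cons, Multiset.sum_cons]
      omega
    · obtain ⟨a, D, rfl, ha, hmem⟩ := hpivot E b (by simpa using hcard hμ) hE hb
      exact ⟨a, D, rfl, ha, (Submodule.Quotient.mk_eq_zero Z).2 hmem⟩
  exact (Submodule.Quotient.mk_eq_zero Z).1 (hrel.eq_zero (by omega) rfl)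

end DeterminantBrackets

section CellChain

variable {α β : Type*} [LinearOrder α] [LinearOrder β] {k : ℕ}

/-- The strict chain of the cells in which the `t`-th row of `u` meets the `t`-th column of `v`. -/
def cellChain (u : Fin k ↪o α) (v : Fin k ↪o β) : Multiset (α × β) :=
  (Finset.univ : Finset (Fin k)).val.map fun t => (u t, v t)

theorem card_cellChain (u : Fin k ↪o α) (v : Fin k ↪o β) : (cellChain u v).card = k := by
  simp [cellChain]

theorem map_fst_cellChain (u : Fin k ↪o α) (v : Fin k ↪o β) :
    (cellChain u v).map Prod.fst = (Finset.univ.map u.toEmbedding).val :=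
  Multiset.map_map _ _ _

theorem map_snd_cellChain (u : Fin k ↪o α) (v : Fin k ↪o β) :
    (cellChain u v).map Prod.snd = (Finset.univ.map v.toEmbedding).val :=
  Multiset.map_map _ _ _

theorem isStrictChain_cellChain (u : Fin k ↪o α) (v : Fin k ↪o β) :
    IsStrictChain CellLT (cellChain u v) := by
  intro a b T h
  have hnodup : (a ::ₘ b ::ₘ T).Nodup :=
    h ▸ Finset.univ.nodup.map fun _ _ hst => u.injective (congrArg Prod.fst hst)
  obtain ⟨s, -, rfl⟩ := Multiset.mem_map.1 (h ▸ Multiset.mem_cons_self a _ : a ∈ cellChain u v)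
  obtain ⟨t, -, rfl⟩ := Multiset.mem_map.1 (h ▸ by simp : b ∈ cellChain u v)
  rcases lt_trichotomy s t with hst | rfl | hts
  · exact .of_rel ⟨u.strictMono hst, v.strictMono hst⟩
  · simp at hnodup
  · exact .of_rel_symm ⟨u.strictMono hts, v.strictMono hts⟩

theorem IsStrictChain.exists_pairwise {σ : Type*} {r : σ → σ → Prop} [IsTrans σ r]
    {S : Multiset σ} (hS : IsStrictChain r S) : ∃ L : List σ, S = L ∧ L.Pairwise r := by
  induction hk : S.card generalizing S with
  | zero => exact ⟨[], Multiset.card_eq_zero.1 hk, .nil⟩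
  | succ k ih =>
    obtain ⟨f, T, rfl, hf⟩ := hS.exists_least (Multiset.card_pos.1 (by omega))
    obtain ⟨L, rfl, hL⟩ := ih (isStrictChain_cons.1 hS).2 (by simpa using hk)
    exact ⟨f :: L, rfl, List.pairwise_cons.2 ⟨hf, hL⟩⟩

theorem IsStrictChain.exists_eq_cellChain {S : Multiset (α × β)} (hS : IsStrictChain CellLT S)
    (hk : S.card = k) : ∃ (u : Fin k ↪o α) (v : Fin k ↪o β), S = cellChain u v := by
  obtain ⟨L, rfl, hL⟩ := hS.exists_pairwise
  rw [Multiset.coe_card] at hk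
  subst hk
  rw [List.pairwise_iff_get] at hL
  refine ⟨OrderEmbedding.ofStrictMono (fun t => (L.get t).1) fun s t hst => (hL s t hst).1,
    OrderEmbedding.ofStrictMono (fun t => (L.get t).2) fun s t hst => (hL s t hst).2, ?_⟩
  exact ((Fin.univ_val_map L.get).trans (congrArg _ (List.ofFn_get L))).symm

theorem card_fin_orderEmbedding (α : Type*) [LinearOrder α] [Finite α] (k : ℕ) :
    Nat.card (Fin k ↪o α) = (Nat.card α).choose k := by
  rw [Nat.card_congr Set.powersetCard.ofFinEmbEquiv, Set.powersetCard.card]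

theorem card_not_cellLT_chain_add_le (α β : Type*) [LinearOrder α] [LinearOrder β] [Finite α]
    [Finite β] (k : ℕ) :
    Nat.card {x : ((Fin (k + 1) ↪o α) × (Fin (k + 1) ↪o β)) × α × β //
        ¬∀ e ∈ cellChain x.1.1 x.1.2, CellLT x.2 e} +
      (Nat.card α).choose (k + 2) * (Nat.card β).choose (k + 2) ≤
    (Nat.card α).choose (k + 1) * (Nat.card β).choose (k + 1) * (Nat.card α * Nat.card β) := by
  classical
  have := Finite.of_injective _ (DFunLike.coe_injective (F := Fin (k + 1) ↪o α))
  have := Finite.of_injective _ (DFunLike.coe_injective (F := Fin (k + 1) ↪o β))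
  let P : ((Fin (k + 1) ↪o α) × (Fin (k + 1) ↪o β)) × α × β → Prop :=
    fun x => ∀ e ∈ cellChain x.1.1 x.1.2, CellLT x.2 e
  let head (w : (Fin (k + 2) ↪o α) × (Fin (k + 2) ↪o β)) : {x // P x} :=
    ⟨(((Fin.succOrderEmb _).trans w.1, (Fin.succOrderEmb _).trans w.2), w.1 0, w.2 0),
      fun e he => by
        obtain ⟨t, -, rfl⟩ := Multiset.mem_map.1 he
        exact ⟨w.1.strictMono t.succ_pos, w.2.strictMono t.succ_pos⟩⟩
  have hhead : Function.Injective head := fun w w' h => by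
    simp only [head, Subtype.mk.injEq, Prod.mk.injEq] at h
    refine Prod.ext (DFunLike.ext _ _ fun t => ?_) (DFunLike.ext _ _ fun t => ?_)
    · exact t.cases h.2.1 (DFunLike.congr_fun h.1.1)
    · exact t.cases h.2.2 (DFunLike.congr_fun h.1.2)
  have hlong := Nat.card_le_card_of_injective head hhead
  have hsplit := Nat.card_congr (Equiv.sumCompl P)
  rw [Nat.card_sum] at hsplit
  simp only [Nat.card_prod, card_fin_orderEmbedding] at hsplit hlong
  rw [← hsplit, add_comm]
  exact Nat.add_le_add_right hlong _

end CellChain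

section LinearIndependence

/-- The increasing enumeration of the complement of the image of `u`. -/
noncomputable def complEmbedding {α : Type*} [LinearOrder α] [Fintype α] {k m : ℕ}
    (h : k + m = Fintype.card α) (u : Fin m ↪o α) : Fin k ↪o α :=
  (Finset.univ.map u.toEmbedding)ᶜ.orderEmbOfFin (by simp [Finset.card_compl, ← h])

theorem map_complEmbedding_add_map_eq_univ_iff {α : Type*} [LinearOrder α] [Fintype α] {k m : ℕ}
    (h : k + m = Fintype.card α) {u v : Fin m ↪o α} :
    (Finset.univ.map (complEmbedding h u).toEmbedding).val + (Finset.univ.map v.toEmbedding).val =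
      Finset.univ.val ↔ u = v := by
  have hcompl : (Finset.univ.map u.toEmbedding)ᶜ.val + (Finset.univ.map u.toEmbedding).val =
      (Finset.univ : Finset α).val := by
    rw [← Finset.disjUnion_val _ _ disjoint_compl_left, Finset.disjUnion_eq_union,
      Finset.union_comm, Finset.union_compl]
  rw [complEmbedding, Finset.map_orderEmbOfFin_univ, ← hcompl, add_right_inj, Finset.val_inj]
  refine ⟨fun huv => OrderEmbedding.range_inj.1 ?_, fun huv => by rw [huv]⟩
  simpa [← Finset.coe_inj, eq_comm] using huv

variable {n : ℕ} {K : Type*} [Field K] {k m : ℕ}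

theorem derivAtZero_det_cellChain_ne_zero_iff (h : k + m = Fintype.card (Fin n))
    {u v u' v' : Fin m ↪o Fin n} :
    derivAtZero (cellChain (complEmbedding h u) (complEmbedding h v) + cellChain u' v')
      (Matrix.mvPolynomialX (Fin n) (Fin n) K).det ≠ 0 ↔ u = u' ∧ v = v' := by
  have hgraph : (∃ τ, cellChain (complEmbedding h u) (complEmbedding h v) + cellChain u' v' =
      permGraph τ) ↔ u = u' ∧ v = v' := by
    rw [exists_eq_permGraph_iff, Multiset.map_add, Multiset.map_add, map_fst_cellChain,
      map_fst_cellChain, map_snd_cellChain, map_snd_cellChain,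
      map_complEmbedding_add_map_eq_univ_iff, map_complEmbedding_add_map_eq_univ_iff]
  rw [← hgraph]
  constructor
  · contrapose!
    exact derivAtZero_det_eq_zero
  · rintro ⟨τ, hτ⟩
    rw [hτ, derivAtZero_det_permGraph]
    rcases Int.units_eq_one_or (Equiv.Perm.sign τ) with h | h <;> simp [h]

theorem wedge_single_ne_zero_iff {σ ι R : Type*} [DecidableEq σ] [LinearOrder ι] [CommRing R]
    [Nontrivial R] (e : ι ≃ σ) {w w' : Fin 2 ↪o ι} :
    wedge (Pi.single (e (w 0)) (1 : R)) (Pi.single (e (w 1)) 1) (e (w' 0), e (w' 1)) ≠ 0 ↔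
      w' = w := by
  have hw : w 0 < w 1 := w.strictMono Fin.zero_lt_one
  have hw' : w' 0 < w' 1 := w'.strictMono Fin.zero_lt_one
  have heq : w' = w ↔ w' 1 = w 1 ∧ w' 0 = w 0 := by
    rw [DFunLike.ext_iff, Fin.forall_fin_two, and_comm]
  have hcross : ¬(w' 0 = w 1 ∧ w' 1 = w 0) := fun h => hw.asymm (h.1 ▸ h.2 ▸ hw')
  simp only [wedge, Pi.single_apply, e.apply_eq_iff_eq, ← ite_and, mul_ite, mul_one, mul_zero, heq]
  rw [if_neg hcross, sub_zero, ite_ne_right_iff, and_iff_left one_ne_zero]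

theorem linearIndependent_bracket_det (h : k + m = Fintype.card (Fin n)) {ι : Type*}
    [LinearOrder ι] (e : ι ≃ Fin n × Fin n) :
    LinearIndependent K fun x : ((Fin m ↪o Fin n) × (Fin m ↪o Fin n)) × (Fin 2 ↪o ι) =>
      bracket k (Matrix.mvPolynomialX (Fin n) (Fin n) K).det (cellChain x.1.1 x.1.2)
        (e (x.2 0)) (e (x.2 1)) := by
  set f := fun x : ((Fin m ↪o Fin n) × (Fin m ↪o Fin n)) × (Fin 2 ↪o ι) =>
    bracket k (Matrix.mvPolynomialX (Fin n) (Fin n) K).det (cellChain x.1.1 x.1.2)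
      (e (x.2 0)) (e (x.2 1))
  let col (x : ((Fin m ↪o Fin n) × (Fin m ↪o Fin n)) × (Fin 2 ↪o ι)) :
      Sym (Fin n × Fin n) k × (Fin n × Fin n) × Fin n × Fin n :=
    (.mk (cellChain (complEmbedding h x.1.1) (complEmbedding h x.1.2)) (card_cellChain _ _),
      e (x.2 0), e (x.2 1))
  have hne : ∀ x y, f y (col x) ≠ 0 ↔ x = y := fun x y => by
    have hval : f y (col x) = derivAtZero
        (cellChain (complEmbedding h x.1.1) (complEmbedding h x.1.2) + cellChain y.1.1 y.1.2)
        (Matrix.mvPolynomialX (Fin n) (Fin n) K).det *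
          wedge (Pi.single (e (y.2 0)) 1) (Pi.single (e (y.2 1)) 1) (e (x.2 0), e (x.2 1)) := rfl
    rw [hval, mul_ne_zero_iff, derivAtZero_det_cellChain_ne_zero_iff, wedge_single_ne_zero_iff,
      ← Prod.ext_iff, ← Prod.ext_iff]
  refine LinearIndependent.of_pairwise_dual_eq_zero_one _
    (fun x => (f x (col x))⁻¹ • LinearMap.proj (col x)) (fun x y hxy => ?_) fun x => ?_
  · simp [not_ne_iff.1 fun h0 => hxy ((hne x y).1 h0)]
  · exact inv_mul_cancel₀ ((hne x x).2 rfl)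

end LinearIndependence

section DeterminantRank

variable {K : Type*} [Field K] {n k l : ℕ}

theorem exists_bracket_det_mem_sup_span (hl : 2 ≤ l) :
    ∃ f : {x : ((Fin (l + 2) ↪o Fin n) × (Fin (l + 2) ↪o Fin n)) × Fin n × Fin n //
        ¬∀ e ∈ cellChain x.1.1 x.1.2, CellLT x.2 e} →
          Sym (Fin n × Fin n) k × (Fin n × Fin n) × Fin n × Fin n → K,
      ∀ (S : Multiset (Fin n × Fin n)) (a b : Fin n × Fin n), S.card = l + 1 →
        bracket k (Matrix.mvPolynomialX (Fin n) (Fin n) K).det S a b ∈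
          Submodule.span K (Set.range
            (koszulFlattening k l (Matrix.mvPolynomialX (Fin n) (Fin n) K).det).row) ⊔
          Submodule.span K (Set.range f) := by
  have hpivot : ∀ x : {x : ((Fin (l + 2) ↪o Fin n) × (Fin (l + 2) ↪o Fin n)) × Fin n × Fin n //
      ¬∀ e ∈ cellChain x.1.1 x.1.2, CellLT x.2 e},
      ∃ a D, cellChain x.1.1.1 x.1.1.2 = a ::ₘ D ∧ IsPivot CellLT x.1.2 a D := fun x =>
    (isStrictChain_cellChain x.1.1.1 x.1.1.2).exists_isPivot (by rw [card_cellChain]; omega) x.1.2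
  choose a D hD ha using hpivot
  refine ⟨fun x => bracket k (Matrix.mvPolynomialX (Fin n) (Fin n) K).det (D x) (a x) x.1.2,
    fun S c d hS => bracket_det_mem_of_pivots hl
      (fun x => Submodule.mem_sup_left (Submodule.subset_span (Set.mem_range_self x)))
      (fun E b hcard hE hb => ?_) S hS c d⟩
  obtain ⟨u, v, rfl⟩ := hE.exists_eq_cellChain hcard
  exact ⟨_, _, hD ⟨((u, v), b), hb⟩, ha ⟨((u, v), b), hb⟩,
    Submodule.mem_sup_right (Submodule.subset_span ⟨⟨((u, v), b), hb⟩, rfl⟩)⟩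

theorem le_rank_koszulFlattening_det (h : k + l + 1 = n) (hl : 2 ≤ l) :
    n.choose (l + 1) ^ 2 * (n ^ 2).choose 2 + n.choose (l + 3) ^ 2 ≤
      (koszulFlattening k l (Matrix.mvPolynomialX (Fin n) (Fin n) K).det).rank +
        n ^ 2 * n.choose (l + 2) ^ 2 := by
  classical
  obtain ⟨f, hf⟩ := exists_bracket_det_mem_sup_span (K := K) (n := n) (k := k) hl
  have hindep := linearIndependent_bracket_det (K := K)
    (show k + (l + 1) = Fintype.card (Fin n) by rw [Fintype.card_fin, ← h, add_assoc])
    finProdFinEquiv.symm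
  have hbrackets := (finrank_span_eq_card hindep).symm.trans_le <|
    (Submodule.finrank_mono <| Submodule.span_le.2 <| Set.range_subset_iff.2 fun x =>
      hf _ _ _ (card_cellChain _ _)).trans (Submodule.finrank_add_le_finrank_add_finrank _ _)
  have hnormal : Module.finrank K (Submodule.span K (Set.range f)) ≤ _ :=
    (finrank_range_le_card f).trans_eq Nat.card_eq_fintype_card.symm
  have hcount := card_not_cellLT_chain_add_le (Fin n) (Fin n) (l + 1)
  replace hcount := (Nat.add_le_add_right hnormal _).trans hcount
  rw [← Matrix.rank_eq_finrank_span_row, ← Nat.card_eq_fintype_card] at hbrackets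
  simp only [Nat.card_prod, card_fin_orderEmbedding, Nat.card_fin, ← sq, add_assoc,
    Nat.reduceAdd] at hbrackets hcount
  linarith

end DeterminantRank

section BorderRankBound

variable {n k l r : ℕ}

theorem symmetricBorderRank_detForm_bound (h : k + l + 1 = n) (hl : 2 ≤ l)
    (hr : symmetricBorderRank (detForm n) = r) :
    n.choose (l + 1) ^ 2 * (n ^ 2).choose 2 + n.choose (l + 3) ^ 2 ≤
      r * (n ^ 2 - 1).choose 2 + n ^ 2 * n.choose (l + 2) ^ 2 := by
  have hrank := rank_koszulFlattening_le_of_symmetricBorderRank_eq h hr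
  rw [Fintype.card_prod, Fintype.card_fin, ← sq] at hrank
  exact (le_rank_koszulFlattening_det h hl).trans (Nat.add_le_add_right hrank _)

theorem symmetricBorderRank_detForm_bound_real (h : k + l + 1 = n) (hl : 2 ≤ l)
    (hr : symmetricBorderRank (detForm n) = r) :
    (n.choose (l + 1) : ℝ) ^ 2 * ((n : ℝ) ^ 2 * ((n : ℝ) ^ 2 - 1) / 2) +
        (n.choose (l + 3) : ℝ) ^ 2 - (n : ℝ) ^ 2 * (n.choose (l + 2) : ℝ) ^ 2 ≤
      r * (((n : ℝ) ^ 2 - 1) * ((n : ℝ) ^ 2 - 2) / 2) := by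
  have hbound := (Nat.cast_le (α := ℝ)).2 (symmetricBorderRank_detForm_bound h hl hr)
  have hn : 1 ≤ n ^ 2 := Nat.one_le_pow _ _ (by omega)
  push_cast [Nat.cast_choose_two, Nat.cast_sub hn] at hbound
  linarith

theorem cast_choose_succ {m j : ℕ} (h : j ≤ m) :
    (m.choose (j + 1) : ℝ) = m.choose j * ((m : ℝ) - j) / (j + 1) := by
  have hsucc := congrArg (Nat.cast (R := ℝ)) (Nat.choose_succ_right_eq m j)
  push_cast [Nat.cast_sub h] at hsucc
  rw [eq_div_iff (by positivity), hsucc]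

theorem symmetricBorderRank_detForm_even_bound {p : ℕ} (hp : 3 ≤ p)
    (hr : symmetricBorderRank (detForm (p + p)) = r) :
    (1 + 8 * (((p + p : ℕ) : ℝ) ^ 3 + 6 * ((p + p : ℕ) : ℝ) ^ 2 - 8) /
      ((((p + p : ℕ) : ℝ) - 1) * (((p + p : ℕ) : ℝ) + 2) * (((p + p : ℕ) : ℝ) + 4) ^ 2 *
        (((p + p : ℕ) : ℝ) ^ 2 - 2))) * ((p + p).choose p : ℝ) ^ 2 ≤ (r : ℝ) := by
  obtain ⟨l, rfl⟩ : ∃ l, p = l + 1 := ⟨p - 1, by omega⟩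
  have hbound := symmetricBorderRank_detForm_bound_real (l := l) (k := l + 1) (by omega)
    (by omega) hr
  rw [cast_choose_succ (j := l + 2) (by omega), cast_choose_succ (j := l + 1) (by omega)] at hbound
  generalize ((l + 1 + (l + 1)).choose (l + 1) : ℝ) = c at hbound ⊢
  have hq : (3 : ℝ) ≤ (l : ℝ) + 1 := by exact_mod_cast hp
  push_cast at hbound ⊢
  obtain ⟨q, hlq⟩ : ∃ q : ℝ, (l : ℝ) = q - 1 := ⟨l + 1, by ring⟩
  simp only [hlq, sub_add_cancel, ← two_mul] at hbound hq ⊢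
  have : 0 < q := by linarith
  have hpred : 2 * q - 1 ≠ 0 := by linarith
  have hsucc : q - 1 + 2 + 1 ≠ 0 := by linarith
  have hsq₁ : 0 < (2 * q) ^ 2 - 1 := by nlinarith
  have hsq₂ : 0 < (2 * q) ^ 2 - 2 := by nlinarith
  have hsq₂' : 2 * q ^ 2 - 1 ≠ 0 := by nlinarith
  refine le_of_mul_le_mul_right (le_trans (le_of_eq ?_) hbound)
    (by positivity : 0 < ((2 * q) ^ 2 - 1) * ((2 * q) ^ 2 - 2) / 2)
  field_simp
  ring

theorem symmetricBorderRank_detForm_odd_bound {p : ℕ} (hp : 2 ≤ p)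
    (hr : symmetricBorderRank (detForm (2 * p + 1)) = r) :
    (1 + 16 * (((2 * p + 1 : ℕ) : ℝ) ^ 2 + 8 * ((2 * p + 1 : ℕ) : ℝ) + 9) /
      ((((2 * p + 1 : ℕ) : ℝ) + 3) * (((2 * p + 1 : ℕ) : ℝ) + 5) ^ 2 *
        (((2 * p + 1 : ℕ) : ℝ) ^ 2 - 2))) * ((2 * p + 1).choose p : ℝ) ^ 2 ≤ (r : ℝ) := by
  have hbound := symmetricBorderRank_detForm_bound_real (l := p) (k := p) (by omega) hp hr
  rw [cast_choose_succ (j := p + 2) (by omega), cast_choose_succ (j := p + 1) (by omega),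
    cast_choose_succ (j := p) (by omega)] at hbound
  generalize ((2 * p + 1).choose p : ℝ) = c at hbound ⊢
  have hq : (2 : ℝ) ≤ (p : ℝ) := by exact_mod_cast hp
  push_cast at hbound ⊢
  generalize (p : ℝ) = q at hq hbound ⊢
  have : 0 < q := by linarith
  have hsq₁ : 0 < (2 * q + 1) ^ 2 - 1 := by nlinarith
  have hsq₂ : 0 < (2 * q + 1) ^ 2 - 2 := by nlinarith
  refine le_of_mul_le_mul_right (le_trans (le_of_eq ?_) hbound)
    (by positivity : 0 < ((2 * q + 1) ^ 2 - 1) * ((2 * q + 1) ^ 2 - 2) / 2)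
  have hsq₂' := hsq₂.ne'
  field_simp
  ring

end BorderRankBound

theorem theorem1p3 (n : ℕ) (hn : 5 ≤ n) :
    ∃ r : ℕ, symmetricBorderRank (detForm n) = (r : ℕ∞) ∧
      (Even n →
        (1 + 8 * ((n : ℝ) ^ 3 + 6 * (n : ℝ) ^ 2 - 8) /
            (((n : ℝ) - 1) * ((n : ℝ) + 2) * ((n : ℝ) + 4) ^ 2 * ((n : ℝ) ^ 2 - 2))) *
          (n.choose (n / 2) : ℝ) ^ 2 ≤ (r : ℝ)) ∧
      (Odd n →
        (1 + 16 * ((n : ℝ) ^ 2 + 8 * (n : ℝ) + 9) /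
            (((n : ℝ) + 3) * ((n : ℝ) + 5) ^ 2 * ((n : ℝ) ^ 2 - 2))) *
          (n.choose ((n - 1) / 2) : ℝ) ^ 2 ≤ (r : ℝ)) := by
  obtain ⟨r, hr⟩ := exists_symmetricBorderRank_eq (by omega) (detForm n)
  refine ⟨r, hr, ?_, ?_⟩
  · rintro ⟨p, rfl⟩
    rw [show (p + p) / 2 = p by omega]
    exact symmetricBorderRank_detForm_even_bound (by omega) hr
  · rintro ⟨p, rfl⟩
    rw [show (2 * p + 1 - 1) / 2 = p by omega]
    exact symmetricBorderRank_detForm_odd_bound (by omega) hr
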